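/- Let $\mathbb{F}$ be a field, and let all algebras be nonzero, unital, associative and finite-dimensional over $\mathbb{F}$. For a finite group $H$, an algebra $\mathcal{C}$ with an action of $H$ by $\mathbb{F}$-algebra automorphisms is called an *$H$-Galois extension of $\mathbb{F}$* if the action is faithful, the fixed subalgebra is $\mathcal{C}^H=\mathbb{F}1$, and the linear map $$\mathcal{C}\otimes_{\mathbb{F}}\mathcal{C}\to \mathrm{Maps}(H,\mathcal{C}),\qquad a\otimes b\mapsto \bigl(h\mapsto a\,(h\cdot b)\bigr)$$ is bijective. Let $G$ be a finite abelian group and let $\mathcal{A}$ be an algebra over $\mathbb{F}$ with an action $\sigma:G\to\mathrm{Aut}_{\mathbb{F}}(\mathcal{A})$, $g\mapsto\sigma_g$. Put $\mathbb{L}:=Z(\mathcal{A})$, the center of $\mathcal{A}$, and let $K$ be the kernel of the homomorphism $\bar\sigma:G\to\mathrm{Aut}_{\mathbb{F}}(\mathbb{L})$, $g\mapsto\sigma_g|_{\mathbb{L}}$. Then $\mathcal{A}$ is a $G$-Galois extension of $\mathbb{F}$ if and only if the following four conditions hold: 1. $\dim_{\mathbb{F}}\mathcal{A}=|G|$; 2.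 $\mathbb{L}$, with the action of $G/K$ induced by $\bar\sigma$, is a $G/K$-Galois extension of $\mathbb{F}$; 3. $\mathbb{F}$ contains a primitive root of unity of degree $\exp(K)$, the exponent of $K$; 4. for every homomorphism $\chi:K\to\mathbb{F}^\times$, the eigenspace $\mathcal{A}_\chi:=\{a\in\mathcal{A}\mid \sigma_k(a)=\chi(k)a\ \text{for all } k\in K\}$ contains an invertible element of $\mathcal{A}$. -/

import Mathlib

/-- The restriction of an algebra automorphism to the center of the algebra. -/
def centerRestrict {F A : Type*} [Field F] [Ring A] [Algebra F A] (e : A ≃ₐ[F] A) :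
    Subalgebra.center F A →ₐ[F] Subalgebra.center F A :=
  (e.toAlgHom.comp (Subalgebra.center F A).val).codRestrict (Subalgebra.center F A) (by
    intro z
    rw [Subalgebra.mem_center_iff]
    intro b
    have h := Subalgebra.mem_center_iff.1 z.2 (e.symm b)
    have h' := congrArg e h
    rw [map_mul, map_mul, e.apply_symm_apply] at h'
    exact h')

theorem coe_centerRestrict {F A : Type*} [Field F] [Ring A] [Algebra F A] (e : A ≃ₐ[F] A)
    (z : Subalgebra.center F A) : ((centerRestrict e z : Subalgebra.center F A) : A) = e z :=
  rfl

/-- For an action `σ` of `G` on `A` by algebra automorphisms, the induced action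
`g ↦ σ_g|_{Z(A)}` on the center of `A`. -/
def centerAction {F A G : Type*} [Field F] [Ring A] [Algebra F A] [Group G]
    (σ : G →* (A ≃ₐ[F] A)) :
    G →* (Subalgebra.center F A ≃ₐ[F] Subalgebra.center F A) where
  toFun g := AlgEquiv.ofAlgHom (centerRestrict (σ g)) (centerRestrict (σ g⁻¹))
    (by
      ext z
      change (σ g) ((σ g⁻¹) (z : A)) = z
      rw [← AlgEquiv.mul_apply, ← map_mul, mul_inv_cancel, map_one, AlgEquiv.one_apply])
    (by
      ext z
      change (σ g⁻¹) ((σ g) (z : A)) = z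
      rw [← AlgEquiv.mul_apply, ← map_mul, inv_mul_cancel, map_one, AlgEquiv.one_apply])
  map_one' := by
    ext z
    change (σ 1) (z : A) = z
    rw [map_one, AlgEquiv.one_apply]
  map_mul' g h := by
    ext z
    change (σ (g * h)) (z : A) = (σ g) ((σ h) (z : A))
    rw [map_mul, AlgEquiv.mul_apply]

theorem coe_centerAction {F A G : Type*} [Field F] [Ring A] [Algebra F A] [Group G]
    (σ : G →* (A ≃ₐ[F] A)) (g : G) (z : Subalgebra.center F A) :
    ((centerAction σ g z : Subalgebra.center F A) : A) = σ g z :=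
  rfl

/-- The linear map `C ⊗ C → Maps(G, C)`, `a ⊗ b ↦ (g ↦ a (g · b))`. -/
noncomputable def galoisMap {F C G : Type*} [Field F] [Ring C] [Algebra F C] [Group G]
    (σ : G →* (C ≃ₐ[F] C)) : TensorProduct F C C →ₗ[F] (G → C) :=
  TensorProduct.lift
    (LinearMap.mk₂ F (fun a b g => a * σ g b)
      (by intro a a' b; funext g; simp [add_mul])
      (by intro c a b; funext g; simp)
      (by intro a b b'; funext g; simp [mul_add])
      (by intro c a b; funext g; simp))

theorem galoisMap_tmul {F C G : Type*} [Field F] [Ring C] [Algebra F C] [Group G]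
    (σ : G →* (C ≃ₐ[F] C)) (a b : C) (g : G) :
    galoisMap σ (TensorProduct.tmul F a b) g = a * σ g b :=
  rfl

/-- The algebra `C` with the action `σ` of the finite group `G` is a `G`-Galois extension of the
field `F`: it is a nonzero finite-dimensional unital algebra, the action is faithful, the fixed
subalgebra is `F 1`, and the map `C ⊗ C → Maps(G, C)`, `a ⊗ b ↦ (g ↦ a (g · b))`, is bijective. -/
structure IsGaloisExtension {F C G : Type*} [Field F] [Ring C] [Algebra F C] [Group G] [Finite G]
    (σ : G →* (C ≃ₐ[F] C)) : Prop where
  nontrivial : Nontrivial C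
  finiteDimensional : FiniteDimensional F C
  faithful : Function.Injective σ
  fixed : ∀ c : C, (∀ g : G, σ g c = c) ↔ c ∈ (⊥ : Subalgebra F C)
  bijective : Function.Bijective (galoisMap σ)

/-- The eigenspace `{a | σ_k(a) = χ(k) a for all k ∈ K}` of a character `χ : K → Fˣ` of a
subgroup `K` of `G`. -/
def characterEigenspace {F A G : Type*} [Field F] [Ring A] [Algebra F A] [Group G]
    (σ : G →* (A ≃ₐ[F] A)) (K : Subgroup G) (χ : K →* Fˣ) : Submodule F A where
  carrier := {a | ∀ k : K, σ (k : G) a = (χ k : F) • a}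
  add_mem' := by
    intro a b ha hb k
    rw [map_add, ha k, hb k, smul_add]
  zero_mem' := by
    intro k
    rw [map_zero, smul_zero]
  smul_mem' := by
    intro c a ha k
    rw [map_smul, ha k, smul_comm]

/-! If `A` is Galois, a preimage of the delta function at `1` gives finitely many pairs with `∑ x *
σ g y = δ_{g,1}`. Consequently every endomorphism of `A` is uniquely `∑ σ g (·) * c g`, which has
two effects. Expanding left multiplications grades `A` by the twisted centers `A_g = {x | σ g d * x
= x * d}` (`component_mem`). Expanding a rank-one map shows that `A` has no proper nonzero
`G`-stable right ideal (`one_mem_of_stable`). As `G` is abelian, each `A_g` is `G`-stable; hence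
`A_g ≠ 0` exactly for `g ∈ K`, and `Z(A) = A^K`. Since `Z(A)` is semilocal, each `A_k` with `k ∈ K`
contains a unit, on which `K` acts by a character. This embeds `K` into its character group, which
yields the root of unity and, by counting, all characters. Conversely, units `u χ` in all
eigenspaces give `|K| * dim A^K ≤ dim A`, which forces `A^K = Z(A)`. Averaging `(u χ)⁻¹ ⊗ u χ` over
characters and combining it with a dual system of the center produces one for `A`; dimensions do the
rest. -/

/-! ### Dual systems and expansion of endomorphisms -/

section DualSystem

variable {F A G : Type*} [Field F] [Ring A] [Algebra F A] [Group G]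

/-- A finite family of pairs `(x, y)` with `∑ x * σ g y = δ_{g, 1}`. -/
structure IsDualSystem (σ : G →* (A ≃ₐ[F] A)) (S : Finset (A × A)) : Prop where
  sum_one : ∑ p ∈ S, p.1 * p.2 = 1
  sum_ne_one : ∀ g, g ≠ 1 → ∑ p ∈ S, p.1 * σ g p.2 = 0

theorem exists_isDualSystem [DecidableEq G] {σ : G →* (A ≃ₐ[F] A)} {t : TensorProduct F A A}
    (ht : galoisMap σ t = Pi.single 1 1) : ∃ S, IsDualSystem σ S := by
  obtain ⟨S, rfl⟩ := TensorProduct.exists_finset t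
  have key : ∀ g, ∑ p ∈ S, p.1 * σ g p.2 = (Pi.single 1 1 : G → A) g := by
    intro g
    rw [← ht, map_sum, Finset.sum_apply]
    rfl
  refine ⟨S, ?_, fun g hg => ?_⟩
  · simpa using key 1
  · rw [key, Pi.single_eq_of_ne hg]

theorem action_apply_apply (σ : G →* (A ≃ₐ[F] A)) (g k : G) (a : A) :
    σ g (σ k a) = σ (g * k) a := by
  rw [map_mul, AlgEquiv.mul_apply]

theorem galoisMap_mul_left (σ : G →* (A ≃ₐ[F] A)) (c : A) (t : TensorProduct F A A) :
    ∃ t', galoisMap σ t' = fun g => c * galoisMap σ t g := by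
  obtain ⟨S, rfl⟩ := TensorProduct.exists_finset t
  refine ⟨∑ p ∈ S, TensorProduct.tmul F (c * p.1) p.2, ?_⟩
  funext g
  simp only [map_sum, Finset.sum_apply, galoisMap_tmul, Finset.mul_sum, mul_assoc]

namespace IsDualSystem

variable {σ : G →* (A ≃ₐ[F] A)} {S : Finset (A × A)}

theorem sum_self (h : IsDualSystem σ S) (g : G) : ∑ p ∈ S, σ g p.1 * σ g p.2 = 1 := by
  simp only [← map_mul, ← map_sum, h.sum_one, map_one]

theorem sum_ne (h : IsDualSystem σ S) {g k : G} (hgk : g ≠ k) :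
    ∑ p ∈ S, σ g p.1 * σ k p.2 = 0 := by
  have h1 := congrArg (σ g) (h.sum_ne_one (g⁻¹ * k) (by rwa [ne_eq, inv_mul_eq_one]))
  simpa only [map_sum, map_mul (σ g), map_zero, action_apply_apply,
    mul_inv_cancel_left] using h1

/-- `galoisMap` is left `A`-linear, and twisting the second entries by `σ k⁻¹` gives a preimage of
the delta function at `k`. -/
theorem surjective_galoisMap [Finite G] (h : IsDualSystem σ S) :
    Function.Surjective (galoisMap σ) := by
  classical
  cases nonempty_fintype G
  intro f
  choose t ht using fun k => galoisMap_mul_left σ (f k)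
    (∑ p ∈ S, TensorProduct.tmul F p.1 (σ k⁻¹ p.2))
  refine ⟨∑ k, t k, ?_⟩
  funext g
  rw [map_sum, Finset.sum_apply, Finset.sum_eq_single g]
  · rw [ht]
    simp only [map_sum, Finset.sum_apply, galoisMap_tmul, action_apply_apply,
      mul_inv_cancel, map_one, AlgEquiv.one_apply, h.sum_one, mul_one]
  · intro k _ hk
    rw [ht]
    simp only [map_sum, Finset.sum_apply, galoisMap_tmul, action_apply_apply]
    rw [h.sum_ne_one _ (by rw [ne_eq, mul_inv_eq_one]; exact hk.symm), mul_zero]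
  · simp

theorem eq_zero_of_sum_eq_zero [Fintype G] (h : IsDualSystem σ S) {c : G → A}
    (hc : ∀ a, ∑ g, σ g a * c g = 0) (k : G) : c k = 0 := by
  have h1 : ∑ p ∈ S, σ k p.1 * ∑ g, σ g p.2 * c g = 0 := by simp [hc]
  simp only [Finset.mul_sum, ← mul_assoc] at h1
  rw [Finset.sum_comm, Finset.sum_eq_single k] at h1
  · rwa [← Finset.sum_mul, h.sum_self, one_mul] at h1
  · intro g _ hg
    rw [← Finset.sum_mul, h.sum_ne hg.symm, zero_mul]
  · simp

/-- Every linear endomorphism of `A` is a right linear combination of the automorphisms `σ g`. -/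
theorem linearMap_apply [Fintype G] (h : IsDualSystem σ S)
    (hfix : ∀ c : A, (∀ g, σ g c = c) → c ∈ (⊥ : Subalgebra F A)) (f : A →ₗ[F] A) (a : A) :
    f a = ∑ g, σ g a * ∑ p ∈ S, σ g p.1 * f p.2 := by
  -- The trace of `a * p.1` is `G`-fixed, hence a scalar; these scalars are the coordinates of `a`
  -- along the `p.2`.
  have ht : ∀ p : A × A, ∃ t : F, algebraMap F A t = ∑ g, σ g (a * p.1) := by
    intro p
    apply Algebra.mem_bot.1
    apply hfix
    intro g
    rw [map_sum]
    simp only [action_apply_apply]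
    exact Fintype.sum_equiv (Equiv.mulLeft g) _ _ fun _ => rfl
  choose t ht using ht
  have ha : a = ∑ p ∈ S, t p • p.2 := by
    simp only [Algebra.smul_def, ht, Finset.sum_mul, map_mul, mul_assoc]
    rw [Finset.sum_comm, Finset.sum_eq_single 1]
    · rw [← Finset.mul_sum]
      simp [h.sum_one]
    · intro g _ hg
      have := h.sum_ne hg
      simp only [map_one, AlgEquiv.one_apply] at this
      rw [← Finset.mul_sum, this, mul_zero]
    · simp
  conv_lhs => rw [ha, map_sum]
  simp only [map_smul]
  simp only [Algebra.smul_def, ht, Finset.sum_mul, Finset.mul_sum, map_mul,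
    mul_assoc]
  rw [Finset.sum_comm]

/-- A nonzero right ideal stable under the group is the whole algebra. -/
theorem one_mem_of_stable [Fintype G] (h : IsDualSystem σ S)
    (hfix : ∀ c : A, (∀ g, σ g c = c) → c ∈ (⊥ : Subalgebra F A)) (R : AddSubgroup A)
    (hmul : ∀ x ∈ R, ∀ a, x * a ∈ R) (hσ : ∀ g, ∀ x ∈ R, σ g x ∈ R) {x : A} (hx : x ∈ R)
    (hx0 : x ≠ 0) : (1 : A) ∈ R := by
  obtain ⟨φ, hφ⟩ := Module.Projective.exists_dual_ne_zero F hx0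
  -- A rank-one endomorphism sending `x` to `1`; its expansion writes `1` through the elements `σ g
  -- x`.
  have h1 := h.linearMap_apply hfix ((LinearMap.toSpanSingleton F A 1).comp ((φ x)⁻¹ • φ)) x
  have h2 : (LinearMap.toSpanSingleton F A 1).comp ((φ x)⁻¹ • φ) x = 1 := by simp [hφ]
  rw [← h2, h1]
  exact R.sum_mem fun g _ => hmul _ (hσ g x hx) _

end IsDualSystem

end DualSystem

/-! ### The grading by twisted centers -/

section TwistedCenter

variable {F A G : Type*} [Field F] [Ring A] [Algebra F A]

/-- The elements `x` with `σ g d * x = x * d` for all `d`. -/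
def twistedCenter [Group G] (σ : G →* (A ≃ₐ[F] A)) (g : G) : AddSubgroup A where
  carrier := {x | ∀ d, σ g d * x = x * d}
  add_mem' := by
    intro x y hx hy d
    rw [mul_add, add_mul, hx d, hy d]
  zero_mem' := by simp
  neg_mem' := by
    intro x hx d
    rw [mul_neg, neg_mul, hx d]

theorem mem_twistedCenter [Group G] {σ : G →* (A ≃ₐ[F] A)} {g : G} {x : A} :
    x ∈ twistedCenter σ g ↔ ∀ d, σ g d * x = x * d := Iff.rfl

theorem mem_twistedCenter_one [Group G] {σ : G →* (A ≃ₐ[F] A)} {x : A} :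
    x ∈ twistedCenter σ 1 ↔ x ∈ Subalgebra.center F A := by
  simp [mem_twistedCenter, Subalgebra.mem_center_iff]

theorem mul_mem_twistedCenter [Group G] {σ : G →* (A ≃ₐ[F] A)} {g k : G} {x y : A}
    (hx : x ∈ twistedCenter σ g) (hy : y ∈ twistedCenter σ k) :
    x * y ∈ twistedCenter σ (g * k) := by
  intro d
  rw [map_mul, AlgEquiv.mul_apply, ← mul_assoc, hx, mul_assoc, hy, mul_assoc]

/-- In general `σ k` carries degree `g` to `k * g * k⁻¹`; commutativity of `G` enters here. -/
theorem apply_mem_twistedCenter [CommGroup G] {σ : G →* (A ≃ₐ[F] A)} {g : G} (k : G) {x : A}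
    (hx : x ∈ twistedCenter σ g) : σ k x ∈ twistedCenter σ g := by
  intro d
  have h := congrArg (σ k) (hx (σ k⁻¹ d))
  simpa only [map_mul (σ k), action_apply_apply, mul_inv_cancel_comm_assoc, mul_inv_cancel,
    map_one, AlgEquiv.one_apply] using h

namespace IsDualSystem

variable [CommGroup G] {σ : G →* (A ≃ₐ[F] A)} {S : Finset (A × A)}

/-- The homogeneous component of degree `g` in the decomposition into twisted centers. -/
def component (_ : IsDualSystem σ S) (g : G) : A →+ A where
  toFun a := ∑ p ∈ S, σ g p.1 * a * p.2
  map_zero' := by simp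
  map_add' a b := by simp [mul_add, add_mul, Finset.sum_add_distrib]

theorem component_apply (h : IsDualSystem σ S) (g : G) (a : A) :
    h.component g a = ∑ p ∈ S, σ g p.1 * a * p.2 := rfl

variable [Fintype G] (h : IsDualSystem σ S)
  (hfix : ∀ c : A, (∀ g, σ g c = c) → c ∈ (⊥ : Subalgebra F A))

include h hfix in
theorem mul_eq_sum_component (a b : A) : a * b = ∑ g, σ g b * h.component g a := by
  simpa [component_apply, mul_assoc] using h.linearMap_apply hfix (LinearMap.mulLeft F a) b

include hfix in
theorem sum_component (a : A) : ∑ g, h.component g a = a := by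
  simpa using (h.mul_eq_sum_component hfix a 1).symm

include hfix in
-- Compare the expansions of `a * (b * d)` and `(a * b) * d`; uniqueness of coefficients gives the
-- twisted relation.
theorem component_mem (g : G) (a : A) : h.component g a ∈ twistedCenter σ g := by
  intro d
  rw [← sub_eq_zero]
  refine h.eq_zero_of_sum_eq_zero
    (c := fun g => σ g d * h.component g a - h.component g a * d) (fun b => ?_) g
  simp only [mul_sub, Finset.sum_sub_distrib, ← mul_assoc, ← map_mul]
  rw [← Finset.sum_mul, ← h.mul_eq_sum_component hfix, ← h.mul_eq_sum_component hfix, mul_assoc,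
    sub_self]

include h in
theorem eq_zero_of_mem_of_mem {g k : G} (hgk : g ≠ k) {x : A} (hg : x ∈ twistedCenter σ g)
    (hk : x ∈ twistedCenter σ k) : x = 0 := by
  classical
  have := h.eq_zero_of_sum_eq_zero
    (c := fun l => if l = g then x else if l = k then -x else 0) (fun b => ?_) g
  · simpa using this
  · have h1 : ∀ l, σ l b * (if l = g then x else if l = k then -x else 0)
        = (if l = g then σ l b * x else 0) + if l = k then -(σ l b * x) else 0 := by
      intro l
      split_ifs <;> simp_all
    simp only [h1, Finset.sum_add_distrib, Finset.sum_ite_eq', Finset.mem_univ, if_true]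
    rw [hg, hk, add_neg_cancel]

include h hfix in
-- The right annihilator of a twisted center is a `G`-stable right ideal, so it is zero or
-- everything.
theorem eq_zero_of_forall_mul_eq_zero {g : G} {b : A} (hb : b ≠ 0)
    (hxb : ∀ x ∈ twistedCenter σ g, x * b = 0) {x : A} (hx : x ∈ twistedCenter σ g) : x = 0 := by
  let R : AddSubgroup A :=
    { carrier := {b | ∀ x ∈ twistedCenter σ g, x * b = 0}
      add_mem' := by
        intro a b ha hb x hx
        rw [mul_add, ha x hx, hb x hx, add_zero]
      zero_mem' := by simp
      neg_mem' := by
        intro a ha x hx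
        rw [mul_neg, ha x hx, neg_zero] }
  have h1 : (1 : A) ∈ R := by
    refine h.one_mem_of_stable hfix R ?_ ?_ (x := b) hxb hb
    · intro a ha c x hx
      rw [← mul_assoc, ha x hx, zero_mul]
    · intro k a ha x hx
      have := congrArg (σ k) (ha _ (apply_mem_twistedCenter k⁻¹ hx))
      simpa only [map_mul, action_apply_apply, mul_inv_cancel, map_one,
        AlgEquiv.one_apply, map_zero] using this
  simpa using h1 x hx

include h hfix in
-- If `σ g` moves a central `z`, then the whole twisted center kills `σ g z - z`.
theorem twistedCenter_eq_bot {g : G} (hg : g ∉ (centerAction σ).ker) {x : A}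
    (hx : x ∈ twistedCenter σ g) : x = 0 := by
  have : ∃ z : Subalgebra.center F A, σ g (z : A) ≠ z := by
    by_contra! hcon
    apply hg
    rw [MonoidHom.mem_ker]
    ext z
    exact hcon z
  obtain ⟨z, hz⟩ := this
  refine h.eq_zero_of_forall_mul_eq_zero hfix (sub_ne_zero.2 hz) (fun y hy => ?_) hx
  rw [mul_sub, ← hy z, sub_eq_zero]
  have h2 := Subalgebra.mem_center_iff.1 (centerAction σ g z).2 y
  rw [coe_centerAction] at h2
  exact h2

include h hfix in
theorem mem_center_of_forall_fixed {a : A}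
    (ha : ∀ g, (∃ x ∈ twistedCenter σ g, x ≠ 0) → σ g a = a) : a ∈ Subalgebra.center F A := by
  rw [Subalgebra.mem_center_iff]
  intro b
  rw [← h.sum_component hfix b, Finset.sum_mul, Finset.mul_sum]
  refine Finset.sum_congr rfl fun g _ => ?_
  have hb := h.component_mem hfix g b
  by_cases h0 : h.component g b = 0
  · simp [h0]
  · rw [← hb, ha g ⟨_, hb, h0⟩]

/-- The degrees of nonzero twisted centers form a subgroup. -/
def support [Nontrivial A] (h : IsDualSystem σ S)
    (hfix : ∀ c : A, (∀ g, σ g c = c) → c ∈ (⊥ : Subalgebra F A)) : Subgroup G :=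
  let M : Submonoid G :=
    { carrier := {g | ∃ x ∈ twistedCenter σ g, x ≠ 0}
      one_mem' := ⟨1, mem_twistedCenter_one.2 (one_mem _), one_ne_zero⟩
      mul_mem' := by
        rintro g k ⟨x, hx, hx0⟩ ⟨y, hy, hy0⟩
        by_contra hcon
        apply hx0
        refine h.eq_zero_of_forall_mul_eq_zero hfix hy0 (fun x' hx' => ?_) hx
        by_contra h0
        exact hcon ⟨_, mul_mem_twistedCenter hx' hy, h0⟩ }
  { M with
    inv_mem' := by
      intro g hg
      have h1 : g ^ (orderOf g - 1) ∈ M := M.pow_mem hg _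
      rwa [← inv_eq_of_mul_eq_one_right (a := g) (b := g ^ (orderOf g - 1))] at h1
      rw [← pow_succ', Nat.sub_add_cancel (orderOf_pos g), pow_orderOf_eq_one] }

theorem mem_support [Nontrivial A] {g : G} :
    g ∈ h.support hfix ↔ ∃ x ∈ twistedCenter σ g, x ≠ 0 := Iff.rfl

omit [CommGroup G] [Fintype G] in
/-- Summing over a subgroup gives elements detecting membership in the subgroup. -/
theorem sum_subgroup_sum [CommGroup G] {σ : G →* (A ≃ₐ[F] A)} (h : IsDualSystem σ S)
    (H : Subgroup G) [Fintype H] (g : G) [Decidable (g ∈ H)] :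
    ∑ p ∈ S, p.1 * σ g (∑ k : H, σ k p.2) = if g ∈ H then 1 else 0 := by
  simp only [map_sum, Finset.mul_sum, action_apply_apply]
  rw [Finset.sum_comm]
  split_ifs with hg
  · rw [Finset.sum_eq_single (⟨g, hg⟩⁻¹ : H)]
    · simp [h.sum_one]
    · intro k _ hk
      apply h.sum_ne_one
      intro h1
      apply hk
      ext
      simpa using (inv_eq_of_mul_eq_one_right h1).symm
    · simp
  · refine Finset.sum_eq_zero fun k _ => h.sum_ne_one _ fun h1 => hg ?_
    rw [eq_inv_of_mul_eq_one_left h1]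
    exact H.inv_mem k.2

omit [CommGroup G] [Fintype G] in
theorem sum_subgroup_fixed [CommGroup G] (σ : G →* (A ≃ₐ[F] A)) (H : Subgroup G) [Fintype H]
    {k : G} (hk : k ∈ H) (a : A) : σ k (∑ l : H, σ l a) = ∑ l : H, σ l a := by
  rw [map_sum]
  simp only [action_apply_apply]
  exact Fintype.sum_equiv (Equiv.mulLeft (⟨k, hk⟩ : H)) _ _ fun _ => rfl

include h hfix in
-- Sums over the support are fixed by it, hence central, hence fixed by `k`. If `k` were outside the
-- support, `sum_subgroup_sum` would tell `k` from `1` on these sums.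
theorem exists_ne_zero_of_mem_ker [Nontrivial A] {k : G} (hk : k ∈ (centerAction σ).ker) :
    ∃ x ∈ twistedCenter σ k, x ≠ 0 := by
  classical
  rw [← h.mem_support hfix]
  by_contra hcon
  have h1 := h.sum_subgroup_sum (h.support hfix) k
  have h2 := h.sum_subgroup_sum (h.support hfix) 1
  rw [if_neg hcon] at h1
  rw [if_pos (one_mem _)] at h2
  have hs : ∀ a, σ k (∑ l : h.support hfix, σ l a) = ∑ l : h.support hfix, σ l a := by
    intro a
    have hc : ∑ l : h.support hfix, σ l a ∈ Subalgebra.center F A :=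
      h.mem_center_of_forall_fixed hfix fun g hg => sum_subgroup_fixed σ _ hg a
    have := DFunLike.congr_fun (MonoidHom.mem_ker.1 hk) ⟨_, hc⟩
    exact congrArg Subtype.val this
  simp only [hs, map_one, AlgEquiv.one_apply] at h1 h2
  exact one_ne_zero (h2.symm.trans h1)

include h hfix in
/-- The center is the algebra of invariants of the kernel of the action on it. -/
theorem mem_center_iff_forall_ker [Nontrivial A] {a : A} :
    a ∈ Subalgebra.center F A ↔ ∀ k ∈ (centerAction σ).ker, σ k a = a := by
  refine ⟨fun ha k hk => ?_, fun ha => ?_⟩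
  · exact congrArg Subtype.val (DFunLike.congr_fun (MonoidHom.mem_ker.1 hk) ⟨a, ha⟩)
  · refine h.mem_center_of_forall_fixed hfix fun g ⟨x, hx, hx0⟩ => ha g ?_
    by_contra hg
    exact hx0 (h.twistedCenter_eq_bot hfix hg hx)

end IsDualSystem

end TwistedCenter

theorem Ideal.apply_mem_of_sum_mul_mem {R ι : Type*} [CommRing R] [Fintype ι] [DecidableEq ι]
    (I : Ideal R) {e w : ι → R} {i : ι}
    (he : ∀ j, e j - (Pi.single j 1 : ι → R) i ∈ I) (h : ∑ j, e j * w j ∈ I) : w i ∈ I := by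
  have h2 : w i = ∑ j, e j * w j - ∑ j, (e j - (Pi.single j 1 : ι → R) i) * w j := by
    simp only [sub_mul, Finset.sum_sub_distrib, sub_sub_cancel]
    rw [Finset.sum_eq_single i]
    · simp
    · intro n _ hn
      simp [Pi.single_eq_of_ne hn.symm]
    · simp
  rw [h2]
  exact I.sub_mem h (I.sum_mem fun j _ => I.mul_mem_right _ (he j))

/-! ### Units in the twisted centers and their characters -/

section Forward

variable {F A G : Type*} [Field F] [Ring A] [Algebra F A]

/-- For each maximal ideal choose a product outside it, and glue the left factors by the Chinese
remainder theorem into `X`. The ideal `X * Q` then lies in no maximal ideal. -/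
theorem exists_mul_eq_one_of_span_eq_top [Finite (MaximalSpectrum (Subalgebra.center F A))]
    {P Q : AddSubgroup A} (hP : ∀ z ∈ Subalgebra.center F A, ∀ x ∈ P, z * x ∈ P)
    (hQ : ∀ z ∈ Subalgebra.center F A, ∀ y ∈ Q, z * y ∈ Q)
    (hPQ : ∀ x ∈ P, ∀ y ∈ Q, x * y ∈ Subalgebra.center F A)
    (hspan : Ideal.span {z : Subalgebra.center F A | ∃ x ∈ P, ∃ y ∈ Q, x * y = z} = ⊤) :
    ∃ x ∈ P, ∃ y ∈ Q, x * y = 1 := by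
  classical
  cases nonempty_fintype (MaximalSpectrum (Subalgebra.center F A))
  have hex : ∀ m : MaximalSpectrum (Subalgebra.center F A),
      ∃ x : P, ∃ y : Q, (⟨x * y, hPQ x x.2 y y.2⟩ : Subalgebra.center F A) ∉ m.asIdeal := by
    intro m
    by_contra! hcon
    apply m.isMaximal.ne_top
    rw [eq_top_iff, ← hspan, Ideal.span_le]
    rintro z ⟨x, hx, y, hy, hz⟩
    have h1 := hcon ⟨x, hx⟩ ⟨y, hy⟩
    simp only [hz] at h1
    exact h1
  choose x y hxy using hex
  have hcop : Pairwise (Function.onFun IsCoprime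
      (MaximalSpectrum.asIdeal : MaximalSpectrum (Subalgebra.center F A) → _)) := by
    intro m n hmn
    exact Ideal.isCoprime_of_isMaximal (fun h => hmn (MaximalSpectrum.ext h))
  choose e he using fun m => Ideal.exists_forall_sub_mem_ideal hcop (Pi.single m 1)
  let X : A := ∑ m, (e m : A) * x m
  have hX : X ∈ P := P.sum_mem fun m _ => hP _ (e m).2 _ (x m).2
  let I : Ideal (Subalgebra.center F A) :=
    { carrier := {z | ∃ y ∈ Q, X * y = z}
      add_mem' := by
        rintro a b ⟨y, hy, hya⟩ ⟨y', hy', hyb⟩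
        exact ⟨y + y', Q.add_mem hy hy', by rw [mul_add, hya, hyb]; rfl⟩
      zero_mem' := ⟨0, Q.zero_mem, by simp⟩
      smul_mem' := by
        rintro c z ⟨y, hy, hyz⟩
        refine ⟨c * y, hQ _ c.2 _ hy, ?_⟩
        rw [← mul_assoc, Subalgebra.mem_center_iff.1 c.2 X, mul_assoc, hyz]
        rfl }
  have hI : I = ⊤ := by
    by_contra hcon
    obtain ⟨m, hm, hIm⟩ := Ideal.exists_le_maximal I hcon
    let M : MaximalSpectrum (Subalgebra.center F A) := ⟨m, hm⟩
    let w : MaximalSpectrum (Subalgebra.center F A) → Subalgebra.center F A :=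
      fun n => ⟨x n * y M, hPQ _ (x n).2 _ (y M).2⟩
    have h1 : ∑ n, e n * w n ∈ m := by
      apply hIm
      refine ⟨y M, (y M).2, ?_⟩
      simp only [X, Finset.sum_mul, mul_assoc]
      simp [w]
    apply hxy M
    change w M ∈ m
    exact m.apply_mem_of_sum_mul_mem (fun n => he n M) h1
  obtain ⟨y, hy, h1⟩ : (1 : Subalgebra.center F A) ∈ I := hI ▸ Submodule.mem_top
  exact ⟨X, hX, y, hy, h1⟩

namespace IsDualSystem

variable [CommGroup G] {σ : G →* (A ≃ₐ[F] A)} {S : Finset (A × A)}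
  [Fintype G] (h : IsDualSystem σ S)
  (hfix : ∀ c : A, (∀ g, σ g c = c) → c ∈ (⊥ : Subalgebra F A))

include h hfix in
-- The products `x * y * a` generate a `G`-stable right ideal, which contains `1`. The degree `1`
-- component is linear over the center, so it maps this ideal into the span and fixes `1`.
theorem span_twistedCenter_mul_eq_top [Nontrivial A] {k : G} (hk : k ∈ (centerAction σ).ker) :
    Ideal.span {z : Subalgebra.center F A |
      ∃ x ∈ twistedCenter σ k, ∃ y ∈ twistedCenter σ k⁻¹, x * y = z} = ⊤ := by
  have hc : ∀ {x y : A}, x ∈ twistedCenter σ k → y ∈ twistedCenter σ k⁻¹ →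
      x * y ∈ Subalgebra.center F A := by
    intro x y hx hy
    rw [← mem_twistedCenter_one (σ := σ), ← mul_inv_cancel k]
    exact mul_mem_twistedCenter hx hy
  let T : Set A := {b | ∃ x ∈ twistedCenter σ k, ∃ y ∈ twistedCenter σ k⁻¹, ∃ a, x * y * a = b}
  obtain ⟨x, hx, hx0⟩ := h.exists_ne_zero_of_mem_ker hfix hk
  obtain ⟨y, hy, hy0⟩ := h.exists_ne_zero_of_mem_ker hfix (inv_mem hk)
  have hne : ∃ x ∈ twistedCenter σ k, x * y ≠ 0 := by
    by_contra! hcon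
    exact hx0 (h.eq_zero_of_forall_mul_eq_zero hfix hy0 hcon hx)
  obtain ⟨x, hx, hxy⟩ := hne
  have h1 : (1 : A) ∈ AddSubgroup.closure T := by
    refine h.one_mem_of_stable hfix _ ?_ ?_
      (AddSubgroup.subset_closure ⟨x, hx, y, hy, 1, mul_one _⟩) hxy
    · intro b hb a
      induction hb using AddSubgroup.closure_induction with
      | mem b hb =>
        obtain ⟨x, hx, y, hy, c, rfl⟩ := hb
        exact AddSubgroup.subset_closure ⟨x, hx, y, hy, c * a, (mul_assoc _ _ _).symm⟩
      | zero => simp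
      | add b c _ _ hb hc => rw [add_mul]; exact add_mem hb hc
      | neg b _ hb => rw [neg_mul]; exact neg_mem hb
    · intro g b hb
      induction hb using AddSubgroup.closure_induction with
      | mem b hb =>
        obtain ⟨x, hx, y, hy, c, rfl⟩ := hb
        exact AddSubgroup.subset_closure ⟨_, apply_mem_twistedCenter g hx, _,
          apply_mem_twistedCenter g hy, σ g c, by simp⟩
      | zero => simp
      | add b c _ _ hb hc => rw [map_add]; exact add_mem hb hc
      | neg b _ hb => rw [map_neg]; exact neg_mem hb
  have hcomp : ∀ a, h.component 1 a ∈ Subalgebra.center F A := fun a =>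
    mem_twistedCenter_one.1 (h.component_mem hfix 1 a)
  have key : ∀ b ∈ AddSubgroup.closure T, (⟨_, hcomp b⟩ : Subalgebra.center F A) ∈
      Ideal.span {z : Subalgebra.center F A |
        ∃ x ∈ twistedCenter σ k, ∃ y ∈ twistedCenter σ k⁻¹, x * y = z} := by
    intro b hb
    induction hb using AddSubgroup.closure_induction with
    | mem b hb =>
      obtain ⟨x, hx, y, hy, c, rfl⟩ := hb
      have h2 : (⟨_, hcomp (x * y * c)⟩ : Subalgebra.center F A)
          = ⟨_, hcomp c⟩ * ⟨_, hc hx hy⟩ := by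
        ext
        have hz := Subalgebra.mem_center_iff.1 (hc hx hy)
        simp only [MulMemClass.coe_mul, component_apply, map_one, AlgEquiv.one_apply,
          Finset.sum_mul]
        refine Finset.sum_congr rfl fun p _ => ?_
        rw [← mul_assoc, hz p.1, hz (p.1 * c * p.2)]
        simp only [mul_assoc]
      rw [h2]
      exact Ideal.mul_mem_left _ _ (Ideal.subset_span ⟨x, hx, y, hy, rfl⟩)
    | zero =>
      convert Ideal.zero_mem _
      exact map_zero _
    | add b c _ _ hb hc =>
      convert Ideal.add_mem _ hb hc
      exact map_add _ _ _
    | neg b _ hb =>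
      convert neg_mem hb
      exact map_neg _ _
  rw [Ideal.eq_top_iff_one]
  convert key 1 h1
  simp [component_apply, h.sum_one]

include h hfix in
theorem exists_unit_mem_twistedCenter [FiniteDimensional F A] [Nontrivial A] {k : G}
    (hk : k ∈ (centerAction σ).ker) :
    ∃ u : Aˣ, (u : A) ∈ twistedCenter σ k ∧ (↑u⁻¹ : A) ∈ twistedCenter σ k⁻¹ := by
  have : IsArtinianRing (Subalgebra.center F A) := IsArtinianRing.of_finite F _
  have hstab : ∀ g, ∀ z ∈ Subalgebra.center F A, ∀ x ∈ twistedCenter σ g,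
      z * x ∈ twistedCenter σ g := by
    intro g z hz x hx
    rw [← one_mul g]
    exact mul_mem_twistedCenter (mem_twistedCenter_one.2 hz) hx
  have hc : ∀ g l, g * l = 1 → ∀ x ∈ twistedCenter σ g, ∀ y ∈ twistedCenter σ l,
      x * y ∈ Subalgebra.center F A := by
    intro g l hgl x hx y hy
    rw [← mem_twistedCenter_one (σ := σ), ← hgl]
    exact mul_mem_twistedCenter hx hy
  obtain ⟨x, hx, y, hy, hxy⟩ := exists_mul_eq_one_of_span_eq_top (hstab k) (hstab k⁻¹)
    (hc _ _ (mul_inv_cancel k)) (h.span_twistedCenter_mul_eq_top hfix hk)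
  have hz := Subalgebra.mem_center_iff.1 (hc _ _ (inv_mul_cancel k) y hy x hx)
  have hyx : y * x = 1 := by
    calc y * x = (y * x) * (x * y) := by rw [hxy, mul_one]
      _ = (x * (y * x)) * y := by rw [← mul_assoc, hz]
      _ = (x * y) * (x * y) := by simp only [mul_assoc]
      _ = 1 := by rw [hxy, one_mul]
  exact ⟨⟨x, y, hxy, hyx⟩, hx, hy⟩

include h hfix in
/-- Units in a twisted center are eigenvectors for a character of the kernel. -/
theorem exists_character [Nontrivial A] {k : G} {u : Aˣ} (hu : (u : A) ∈ twistedCenter σ k)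
    (hu' : (↑u⁻¹ : A) ∈ twistedCenter σ k⁻¹) :
    ∃ χ : (centerAction σ).ker →* Fˣ, (u : A) ∈ characterEigenspace σ (centerAction σ).ker χ := by
  have hc : ∀ g, σ g u * ↑u⁻¹ ∈ Subalgebra.center F A := by
    intro g
    rw [← mem_twistedCenter_one (σ := σ), ← mul_inv_cancel k]
    exact mul_mem_twistedCenter (apply_mem_twistedCenter g hu) hu'
  have hmul : ∀ g, σ g u * ↑u⁻¹ * u = σ g u := by
    intro g
    rw [mul_assoc, Units.inv_mul, mul_one]
  have hker := fun a => h.mem_center_iff_forall_ker hfix (a := a)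
  have hF : ∀ l ∈ (centerAction σ).ker, ∃ t : F, algebraMap F A t = σ l u * ↑u⁻¹ := by
    intro l hl
    apply Algebra.mem_bot.1
    apply hfix
    intro g
    -- Write `σ g u = z * u` with `z` central, so `σ l` fixes `z`. Commuting `σ l` with `σ g` then
    -- shows that `σ g` fixes `σ l u * u⁻¹`.
    have h1 : σ l (σ g u) = σ g (σ l u) := by
      rw [action_apply_apply, action_apply_apply, mul_comm]
    rw [← hmul g, ← hmul l, map_mul (σ l) (_ * _), map_mul (σ g) (_ * _),
      (hker _).1 (hc g) l hl] at h1
    nth_rewrite 1 [← hmul l] at h1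
    rw [← mul_assoc, ← Subalgebra.mem_center_iff.1 (hc g), mul_assoc, hmul] at h1
    exact ((u.isUnit.map (σ g)).mul_right_cancel h1).symm
  choose t ht using fun l : (centerAction σ).ker => hF l l.2
  have hσ : ∀ l : (centerAction σ).ker, σ (l : G) (u : A) = t l • (u : A) := by
    intro l
    rw [Algebra.smul_def, ht, hmul]
  have hcancel : ∀ {a b : F}, a • (u : A) = b • (u : A) → a = b := by
    intro a b hab
    exact smul_left_injective F u.ne_zero hab
  have ht1 : t 1 = 1 := hcancel (by rw [← hσ]; simp)
  have htmul : ∀ l m, t (l * m) = t l * t m := by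
    intro l m
    apply hcancel
    rw [← hσ, Subgroup.coe_mul, map_mul, AlgEquiv.mul_apply, hσ m, map_smul, hσ l, smul_smul,
      mul_comm]
  exact ⟨MonoidHom.toHomUnits ⟨⟨t, ht1⟩, htmul⟩, fun l => hσ l⟩

end IsDualSystem

end Forward

/-! ### Characters and roots of unity -/

section Characters

/-- For `k` of order `exp K`, the values of `ψ k` form a finite, hence cyclic, subgroup of `Fˣ`,
whose generator has the order of `ψ k`. -/
theorem exists_isPrimitiveRoot_exponent {F K : Type*} [Field F] [CommGroup K] [Finite K]
    (ψ : K →* (K →* Fˣ)) (hψ : Function.Injective ψ) :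
    ∃ ζ : F, IsPrimitiveRoot ζ (Monoid.exponent K) := by
  obtain ⟨k, hk⟩ := Monoid.exists_orderOf_eq_exponent (Monoid.ExponentExists.of_finite (G := K))
  have hord : orderOf (ψ k) = Monoid.exponent K := by rw [orderOf_injective ψ hψ, hk]
  have : Finite (ψ k).range := Finite.of_surjective _ (ψ k).rangeRestrict_surjective
  obtain ⟨ζ, hζ⟩ := IsCyclic.exists_generator (α := (ψ k).range)
  refine ⟨((ζ : Fˣ) : F), ?_⟩
  rw [IsPrimitiveRoot.coe_units_iff, ← hord]
  convert IsPrimitiveRoot.orderOf (ζ : Fˣ)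
  refine Nat.dvd_antisymm ?_ ?_
  · rw [orderOf_dvd_iff_pow_eq_one]
    ext l
    obtain ⟨n, hn⟩ := hζ ⟨ψ k l, l, rfl⟩
    have h1 : ψ k l = (ζ : Fˣ) ^ n := (congrArg Subtype.val hn).symm
    rw [MonoidHom.pow_apply, h1, ← zpow_natCast, zpow_comm, zpow_natCast, pow_orderOf_eq_one]
    simp
  · rw [orderOf_dvd_iff_pow_eq_one]
    obtain ⟨l, hl⟩ := ζ.2
    rw [← hl, ← MonoidHom.pow_apply, pow_orderOf_eq_one, MonoidHom.one_apply]

theorem hasEnoughRootsOfUnity_of_isPrimitiveRoot {F : Type*} [Field F] {n : ℕ} [NeZero n] {ζ : F}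
    (hζ : IsPrimitiveRoot ζ n) : HasEnoughRootsOfUnity F n :=
  ⟨⟨ζ, hζ⟩, rootsOfUnity.isCyclic F n⟩

variable {F A G : Type*} [Field F] [Ring A] [Algebra F A] [Group G] {σ : G →* (A ≃ₐ[F] A)}
  {K : Subgroup G}

theorem mul_mem_characterEigenspace {χ ψ : K →* Fˣ} {a b : A}
    (ha : a ∈ characterEigenspace σ K χ) (hb : b ∈ characterEigenspace σ K ψ) :
    a * b ∈ characterEigenspace σ K (χ * ψ) := by
  intro k
  rw [map_mul, ha k, hb k, smul_mul_smul_comm, MonoidHom.mul_apply, Units.val_mul]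

theorem inv_mem_characterEigenspace {χ : K →* Fˣ} {u : Aˣ}
    (hu : (u : A) ∈ characterEigenspace σ K χ) :
    (↑u⁻¹ : A) ∈ characterEigenspace σ K χ⁻¹ := by
  intro k
  apply (u.isUnit.map (σ (k : G))).mul_left_cancel
  rw [← map_mul, Units.mul_inv, map_one, hu k, smul_mul_smul_comm, Units.mul_inv,
    ← Units.val_mul, MonoidHom.inv_apply, mul_inv_cancel, Units.val_one, one_smul]

theorem eq_of_mem_characterEigenspace {χ ψ : K →* Fˣ} {a : A}
    (hχ : a ∈ characterEigenspace σ K χ) (hψ : a ∈ characterEigenspace σ K ψ) (ha : a ≠ 0) :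
    χ = ψ := by
  ext k
  exact smul_left_injective F ha ((hχ k).symm.trans (hψ k))

end Characters

/-! ### Necessity of the conditions -/

section Forward

variable {F A G : Type*} [Field F] [Ring A] [Algebra F A] [CommGroup G] {σ : G →* (A ≃ₐ[F] A)}

/-- The quotient `u * v⁻¹` has degree `k * l⁻¹`. Both degree `1` and trivial character mean lying in
`Z(A) = A^K`. -/
theorem IsDualSystem.character_eq_iff [Fintype G] [Nontrivial A] {S : Finset (A × A)}
    (h : IsDualSystem σ S) (hfix : ∀ c : A, (∀ g, σ g c = c) → c ∈ (⊥ : Subalgebra F A))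
    {k l : G} {u v : Aˣ} (hu : (u : A) ∈ twistedCenter σ k)
    (hv : (↑v⁻¹ : A) ∈ twistedCenter σ l⁻¹) {χ ψ : (centerAction σ).ker →* Fˣ}
    (hχ : (u : A) ∈ characterEigenspace σ (centerAction σ).ker χ)
    (hψ : (v : A) ∈ characterEigenspace σ (centerAction σ).ker ψ) : χ = ψ ↔ k = l := by
  have h1 := mul_mem_characterEigenspace hχ (inv_mem_characterEigenspace hψ)
  have h2 := mul_mem_twistedCenter hu hv
  have h0 : (u * ↑v⁻¹ : A) ≠ 0 := (u * v⁻¹).ne_zero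
  rw [← mul_inv_eq_one, ← mul_inv_eq_one (a := k)]
  constructor
  · intro hone
    by_contra hne
    refine h0 (h.eq_zero_of_mem_of_mem hne h2 ?_)
    rw [mem_twistedCenter_one, h.mem_center_iff_forall_ker hfix]
    intro m hm
    rw [hone] at h1
    simpa using h1 ⟨m, hm⟩
  · intro hone
    rw [hone, mem_twistedCenter_one, h.mem_center_iff_forall_ker hfix] at h2
    refine eq_of_mem_characterEigenspace h1 (fun m => ?_) h0
    simpa using h2 m m.2

theorem IsDualSystem.exists_injective_characters [Fintype G] [Nontrivial A]
    [FiniteDimensional F A] {S : Finset (A × A)} (h : IsDualSystem σ S)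
    (hfix : ∀ c : A, (∀ g, σ g c = c) → c ∈ (⊥ : Subalgebra F A)) :
    ∃ ψ : (centerAction σ).ker →* ((centerAction σ).ker →* Fˣ), Function.Injective ψ ∧
      ∀ k, ∃ a ∈ characterEigenspace σ (centerAction σ).ker (ψ k), IsUnit a := by
  choose u hu hu' using fun k : (centerAction σ).ker => h.exists_unit_mem_twistedCenter hfix k.2
  choose χ hχ using fun k => h.exists_character hfix (hu k) (hu' k)
  refine ⟨MonoidHom.mk' χ fun k l => ?_, fun k l hkl => ?_, fun k => ⟨u k, hχ k, (u k).isUnit⟩⟩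
  · symm
    have h1 : ((u k * u l : Aˣ) : A) ∈ twistedCenter σ (k * l : G) :=
      mul_mem_twistedCenter (hu k) (hu l)
    exact (h.character_eq_iff hfix h1 (hu' (k * l))
      (mul_mem_characterEigenspace (hχ k) (hχ l)) (hχ (k * l))).2 rfl
  · ext
    exact (h.character_eq_iff hfix (hu k) (hu' l) (hχ k) (hχ l)).1 hkl

/-- The linear map `A ⊗ Z(A) → Maps(G / K, A)`, `a ⊗ z ↦ (q ↦ a (q · z))`. -/
noncomputable def centerGaloisMap (σ : G →* (A ≃ₐ[F] A)) :
    TensorProduct F A (Subalgebra.center F A) →ₗ[F] (G ⧸ (centerAction σ).ker → A) :=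
  TensorProduct.lift
    (LinearMap.mk₂ F (fun a z q => a * (QuotientGroup.kerLift (centerAction σ) q z : A))
      (by intro a a' b; funext g; simp [add_mul])
      (by intro c a b; funext g; simp)
      (by intro a b b'; funext g; simp [mul_add])
      (by intro c a b; funext g; simp))

theorem centerGaloisMap_tmul (a : A) (z : Subalgebra.center F A)
    (q : G ⧸ (centerAction σ).ker) : centerGaloisMap σ (TensorProduct.tmul F a z) q =
      a * (QuotientGroup.kerLift (centerAction σ) q z : A) := rfl

theorem IsDualSystem.surjective_centerGaloisMap [Fintype G] [Nontrivial A] {S : Finset (A × A)}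
    (h : IsDualSystem σ S) (hfix : ∀ c : A, (∀ g, σ g c = c) → c ∈ (⊥ : Subalgebra F A)) :
    Function.Surjective (centerGaloisMap σ) := by
  classical
  intro f
  have hs : ∀ a, ∑ k : (centerAction σ).ker, σ k a ∈ Subalgebra.center F A := fun a =>
    (h.mem_center_iff_forall_ker hfix).2 fun k hk => IsDualSystem.sum_subgroup_fixed σ _ hk a
  refine ⟨∑ q : G ⧸ (centerAction σ).ker, ∑ p ∈ S, TensorProduct.tmul F (f q * p.1)
    (QuotientGroup.kerLift (centerAction σ) q⁻¹ ⟨_, hs p.2⟩), ?_⟩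
  funext r
  have key : ∀ q : G ⧸ (centerAction σ).ker,
      ∑ p ∈ S, p.1 * (QuotientGroup.kerLift (centerAction σ) q ⟨_, hs p.2⟩ : A)
        = if q = 1 then 1 else 0 := by
    intro q
    induction q using QuotientGroup.induction_on with
    | H g =>
      simp only [QuotientGroup.kerLift_mk, coe_centerAction, QuotientGroup.eq_one_iff]
      exact h.sum_subgroup_sum _ g
  simp only [map_sum, Finset.sum_apply, centerGaloisMap_tmul, mul_assoc, action_apply_apply]
  simp only [← Finset.mul_sum, key, mul_inv_eq_one, mul_ite, mul_one, mul_zero]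
  simp

theorem injective_galoisMap_center (h : Function.Injective (galoisMap σ)) :
    Function.Injective (galoisMap (QuotientGroup.kerLift (centerAction σ))) := by
  have hcomp : ∀ t g, galoisMap σ (TensorProduct.map (Subalgebra.center F A).val.toLinearMap
      (Subalgebra.center F A).val.toLinearMap t) g =
      (galoisMap (QuotientGroup.kerLift (centerAction σ)) t g : Subalgebra.center F A) := by
    intro t g
    obtain ⟨S, rfl⟩ := TensorProduct.exists_finset t
    simp only [map_sum, TensorProduct.map_tmul, Finset.sum_apply, galoisMap_tmul,
      QuotientGroup.kerLift_mk, AddSubmonoidClass.coe_finsetSum]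
    rfl
  intro t t' htt'
  apply TensorProduct.map_injective_of_flat_flat (Subalgebra.center F A).val.toLinearMap
    (Subalgebra.center F A).val.toLinearMap Subtype.val_injective Subtype.val_injective
  apply h
  funext g
  rw [hcomp, hcomp, htt']

theorem IsGaloisExtension.finrank_eq {G C : Type*} [Group G] [Ring C] [Algebra F C] [Finite G]
    {τ : G →* (C ≃ₐ[F] C)} (h : IsGaloisExtension τ) : Module.finrank F C = Nat.card G := by
  cases nonempty_fintype G
  have := h.nontrivial
  have := h.finiteDimensional
  have h1 := (LinearEquiv.ofBijective _ h.bijective).finrank_eq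
  rw [Module.finrank_tensorProduct, Module.finrank_pi_fintype, Finset.sum_const, smul_eq_mul,
    Finset.card_univ, ← Nat.card_eq_fintype_card] at h1
  exact Nat.eq_of_mul_eq_mul_right Module.finrank_pos h1

theorem IsGaloisExtension.center [Finite G] (h : IsGaloisExtension σ) :
    IsGaloisExtension (QuotientGroup.kerLift (centerAction σ)) := by
  classical
  cases nonempty_fintype G
  have := h.nontrivial
  have := h.finiteDimensional
  obtain ⟨t, ht⟩ := h.bijective.2 (Pi.single 1 1)
  obtain ⟨S, hS⟩ := exists_isDualSystem ht
  have hfix := fun c => (h.fixed c).1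
  have hbot : ∀ c : Subalgebra.center F A,
      c ∈ (⊥ : Subalgebra F (Subalgebra.center F A)) ↔ (c : A) ∈ (⊥ : Subalgebra F A) := by
    intro c
    rw [Algebra.mem_bot, Algebra.mem_bot]
    exact exists_congr fun r => Subtype.ext_iff
  -- Injectivity on `L ⊗ L` gives `dim L ≤ |G/K|`; surjectivity from `A ⊗ L` gives the reverse.
  have hinj := injective_galoisMap_center h.bijective.1
  have hle := LinearMap.finrank_le_finrank_of_injective hinj
  have hge := LinearMap.finrank_range_le (centerGaloisMap σ)
  rw [LinearMap.range_eq_top.2 (hS.surjective_centerGaloisMap hfix), finrank_top] at hge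
  rw [Module.finrank_tensorProduct, Module.finrank_pi_fintype, Finset.sum_const,
    smul_eq_mul] at hle hge
  have hrank : Module.finrank F (Subalgebra.center F A)
      = Finset.univ.card (α := G ⧸ (centerAction σ).ker) := by
    refine le_antisymm (Nat.le_of_mul_le_mul_right hle Module.finrank_pos) ?_
    rw [mul_comm] at hge
    exact Nat.le_of_mul_le_mul_left hge Module.finrank_pos
  refine ⟨inferInstance, inferInstance, QuotientGroup.kerLift_injective _, fun c => ?_, hinj, ?_⟩
  · rw [hbot, ← h.fixed]
    refine ⟨fun hc g => ?_, fun hc q => ?_⟩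
    · exact congrArg Subtype.val (hc (g : G ⧸ (centerAction σ).ker))
    · induction q using QuotientGroup.induction_on with
      | H g => exact Subtype.ext (hc g)
  · refine (LinearMap.injective_iff_surjective_of_finrank_eq_finrank ?_).1 hinj
    rw [Module.finrank_tensorProduct, Module.finrank_pi_fintype, Finset.sum_const, smul_eq_mul,
      hrank]

theorem IsGaloisExtension.conditions [Finite G] (h : IsGaloisExtension σ) :
    (∃ ζ : F, IsPrimitiveRoot ζ (Monoid.exponent (centerAction σ).ker)) ∧
      ∀ χ : (centerAction σ).ker →* Fˣ,
        ∃ a ∈ characterEigenspace σ (centerAction σ).ker χ, IsUnit a := by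
  classical
  cases nonempty_fintype G
  have := h.nontrivial
  have := h.finiteDimensional
  obtain ⟨t, ht⟩ := h.bijective.2 (Pi.single 1 1)
  obtain ⟨S, hS⟩ := exists_isDualSystem ht
  obtain ⟨ψ, hψ, hunit⟩ := hS.exists_injective_characters fun c => (h.fixed c).1
  obtain ⟨ζ, hζ⟩ := exists_isPrimitiveRoot_exponent ψ hψ
  refine ⟨⟨ζ, hζ⟩, fun χ => ?_⟩
  have : NeZero (Monoid.exponent (centerAction σ).ker) := ⟨Monoid.exponent_ne_zero_of_finite⟩
  have := hasEnoughRootsOfUnity_of_isPrimitiveRoot hζ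
  obtain ⟨k, rfl⟩ := (hψ.bijective_of_nat_card_le
    (CommGroup.card_monoidHom_of_hasEnoughRootsOfUnity (centerAction σ).ker F).le).2 χ
  exact hunit k

end Forward

/-! ### Sufficiency of the conditions -/

section Backward

theorem natCast_card_ne_zero_of_isPrimitiveRoot {F K : Type*} [Field F] [CommGroup K] [Finite K]
    {ζ : F} (hζ : IsPrimitiveRoot ζ (Monoid.exponent K)) : (Nat.card K : F) ≠ 0 := by
  have : NeZero (Monoid.exponent K) := ⟨Monoid.exponent_ne_zero_of_finite⟩
  have := hζ.neZero'
  intro h0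
  obtain ⟨c, hc⟩ := card_dvd_exponent_pow_rank K
  have h1 := congrArg (Nat.cast (R := F)) hc
  rw [Nat.cast_mul, h0, zero_mul, Nat.cast_pow] at h1
  exact NeZero.ne _ (eq_zero_of_pow_eq_zero h1)

theorem sum_characters_apply {F K : Type*} [Field F] [CommGroup K] [Finite K]
    [Fintype (K →* Fˣ)] [DecidableEq K] {ζ : F} (hζ : IsPrimitiveRoot ζ (Monoid.exponent K))
    (k : K) : ∑ χ : K →* Fˣ, (χ k : F) = if k = 1 then (Nat.card K : F) else 0 := by
  have : NeZero (Monoid.exponent K) := ⟨Monoid.exponent_ne_zero_of_finite⟩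
  have := hasEnoughRootsOfUnity_of_isPrimitiveRoot hζ
  split_ifs with hk
  · simp [hk, ← Nat.card_eq_fintype_card,
      CommGroup.card_monoidHom_of_hasEnoughRootsOfUnity K F]
  · refine sum_hom_units_eq_zero ((Units.coeHom F).comp (MonoidHom.eval k)) fun h1 => ?_
    obtain ⟨χ, hχ⟩ := CommGroup.exists_apply_ne_one_of_hasEnoughRootsOfUnity K F hk
    exact hχ (Units.ext (DFunLike.congr_fun h1 χ))

variable {F A G : Type*} [Field F] [Ring A] [Algebra F A]

/-- Applying `φ ∘ σ k` for a functional `φ` reduces this to linear independence of characters. -/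
theorem eq_zero_of_sum_mem_characterEigenspace [Group G] {σ : G →* (A ≃ₐ[F] A)} {K : Subgroup G}
    [Fintype (K →* Fˣ)] {a : (K →* Fˣ) → A} (ha : ∀ χ, a χ ∈ characterEigenspace σ K χ)
    (hsum : ∑ χ, a χ = 0) (χ : K →* Fˣ) : a χ = 0 := by
  have hli : LinearIndependent F fun (χ : K →* Fˣ) (k : K) => (χ k : F) := by
    have := linearIndependent_monoidHom K F
    refine this.comp (fun χ : K →* Fˣ => (Units.coeHom F).comp χ) fun χ ψ h => ?_
    ext k
    exact DFunLike.congr_fun h k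
  rw [← Module.forall_dual_apply_eq_zero_iff F]
  intro φ
  refine Fintype.linearIndependent_iff.1 hli (fun χ => φ (a χ)) ?_ χ
  funext k
  have h1 := congrArg (fun x => φ (σ (k : G) x)) hsum
  simp only [map_sum, map_zero, ha _ k, map_smul, smul_eq_mul] at h1
  simpa [mul_comm] using h1

variable [CommGroup G] [Finite G] {σ : G →* (A ≃ₐ[F] A)}

/-- The translates `A^K * u χ` are independent, so `|K| * dim A^K ≤ |G|`. The center lies in `A^K`
and already has dimension `|G/K|`. -/
theorem mem_center_of_forall_ker [FiniteDimensional F A]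
    (hdim : Module.finrank F A = Nat.card G)
    (hL : IsGaloisExtension (QuotientGroup.kerLift (centerAction σ)))
    {ζ : F} (hζ : IsPrimitiveRoot ζ (Monoid.exponent (centerAction σ).ker))
    {u : ((centerAction σ).ker →* Fˣ) → Aˣ}
    (hu : ∀ χ, (u χ : A) ∈ characterEigenspace σ (centerAction σ).ker χ) {a : A}
    (ha : ∀ k ∈ (centerAction σ).ker, σ k a = a) : a ∈ Subalgebra.center F A := by
  have : NeZero (Monoid.exponent (centerAction σ).ker) := ⟨Monoid.exponent_ne_zero_of_finite⟩
  have := hasEnoughRootsOfUnity_of_isPrimitiveRoot hζ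
  cases nonempty_fintype ((centerAction σ).ker →* Fˣ)
  let E := characterEigenspace σ (centerAction σ).ker 1
  have hle : Subalgebra.toSubmodule (Subalgebra.center F A) ≤ E := by
    intro z hz k
    have := DFunLike.congr_fun (MonoidHom.mem_ker.1 k.2) (⟨z, hz⟩ : Subalgebra.center F A)
    rw [MonoidHom.one_apply, Units.val_one, one_smul]
    exact congrArg Subtype.val this
  let Φ : (((centerAction σ).ker →* Fˣ) → E) →ₗ[F] A :=
    ∑ χ, ((LinearMap.mulRight F (u χ : A)).comp E.subtype).comp (LinearMap.proj χ)
  have hΦ : Function.Injective Φ := by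
    rw [← LinearMap.ker_eq_bot, LinearMap.ker_eq_bot']
    intro f hf
    funext χ
    have h1 := eq_zero_of_sum_mem_characterEigenspace (σ := σ) (a := fun χ => (f χ : A) * u χ)
      (fun χ => by
        intro k
        simpa using mul_mem_characterEigenspace (f χ).2 (hu χ) k)
      (by simpa [Φ] using hf) χ
    exact Subtype.ext ((u χ).mul_left_eq_zero.1 h1)
  have h1 := LinearMap.finrank_le_finrank_of_injective hΦ
  rw [Module.finrank_pi_fintype, Finset.sum_const, smul_eq_mul, Finset.card_univ,
    ← Nat.card_eq_fintype_card, CommGroup.card_monoidHom_of_hasEnoughRootsOfUnity _ F, hdim,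
    Subgroup.card_eq_card_quotient_mul_card_subgroup (centerAction σ).ker, mul_comm] at h1
  have h2 : Module.finrank F E ≤
      Module.finrank F (Subalgebra.toSubmodule (Subalgebra.center F A)) :=
    (Nat.le_of_mul_le_mul_right h1 Nat.card_pos).trans hL.finrank_eq.ge
  have h3 := Submodule.eq_of_le_of_finrank_le hle h2
  rw [← Subalgebra.mem_toSubmodule, h3]
  intro k
  simpa using ha k k.2

theorem exists_isDualSystem_of_center
    (hL : IsGaloisExtension (QuotientGroup.kerLift (centerAction σ)))
    {ζ : F} (hζ : IsPrimitiveRoot ζ (Monoid.exponent (centerAction σ).ker))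
    {u : ((centerAction σ).ker →* Fˣ) → Aˣ}
    (hu : ∀ χ, (u χ : A) ∈ characterEigenspace σ (centerAction σ).ker χ) :
    ∃ S, IsDualSystem σ S := by
  classical
  have : NeZero (Monoid.exponent (centerAction σ).ker) := ⟨Monoid.exponent_ne_zero_of_finite⟩
  have := hasEnoughRootsOfUnity_of_isPrimitiveRoot hζ
  cases nonempty_fintype ((centerAction σ).ker →* Fˣ)
  have hcard := natCast_card_ne_zero_of_isPrimitiveRoot hζ
  set n : F := (Nat.card (centerAction σ).ker : F)
  obtain ⟨t, ht⟩ := hL.bijective.2 (Pi.single 1 1)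
  obtain ⟨T, rfl⟩ := TensorProduct.exists_finset t
  have hT : ∀ g : G, ∑ p ∈ T, (p.1 : A) * σ g p.2 = if g ∈ (centerAction σ).ker then 1 else 0 := by
    intro g
    have h1 := congrFun ht (g : G ⧸ (centerAction σ).ker)
    simp only [map_sum, Finset.sum_apply, galoisMap_tmul, QuotientGroup.kerLift_mk] at h1
    have h2 := congrArg Subtype.val h1
    simp only [AddSubmonoidClass.coe_finsetSum, MulMemClass.coe_mul, coe_centerAction,
      Pi.single_apply, QuotientGroup.eq_one_iff] at h2
    rw [h2]
    split_ifs <;> rfl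
  -- As `p.1` is central, the image factors: the sum over `T` detects `g ∈ K`, and by orthogonality
  -- the averaged sum of `χ g` detects `g = 1` within `K`.
  refine exists_isDualSystem (t := ∑ p ∈ T, ∑ χ, TensorProduct.tmul F
    ((p.1 : A) * (n⁻¹ • (↑(u χ)⁻¹ : A))) (u χ * p.2)) ?_
  funext g
  have h1 : galoisMap σ (∑ p ∈ T, ∑ χ, TensorProduct.tmul F
      ((p.1 : A) * (n⁻¹ • (↑(u χ)⁻¹ : A))) (u χ * p.2)) g =
      (∑ χ, n⁻¹ • ((↑(u χ)⁻¹ : A) * σ g (u χ))) * ∑ p ∈ T, (p.1 : A) * σ g p.2 := by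
    simp only [map_sum, Finset.sum_apply, galoisMap_tmul, Finset.mul_sum]
    refine Finset.sum_congr rfl fun p _ => ?_
    rw [← mul_assoc, Subalgebra.mem_center_iff.1 p.1.2, Finset.mul_sum, Finset.sum_mul]
    refine Finset.sum_congr rfl fun χ _ => ?_
    simp only [map_mul, mul_assoc, smul_mul_assoc, mul_smul_comm]
  rw [h1, hT]
  split_ifs with hg
  · have h2 : ∀ χ, n⁻¹ • ((↑(u χ)⁻¹ : A) * σ g (u χ)) = algebraMap F A (n⁻¹ * χ ⟨g, hg⟩) := by
      intro χ
      rw [hu χ ⟨g, hg⟩, mul_smul_comm, Units.inv_mul, smul_smul, Algebra.algebraMap_eq_smul_one]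
    simp only [h2, ← map_sum, ← Finset.mul_sum, sum_characters_apply hζ]
    by_cases h3 : g = 1
    · subst h3
      have : (⟨1, hg⟩ : (centerAction σ).ker) = 1 := rfl
      rw [if_pos this, inv_mul_cancel₀ hcard, map_one, mul_one, Pi.single_eq_same]
    · have : (⟨g, hg⟩ : (centerAction σ).ker) ≠ 1 := fun h => h3 (congrArg Subtype.val h)
      simp [this, h3]
  · have h3 : g ≠ 1 := fun h => hg (h ▸ one_mem _)
    simp [h3]

theorem isGaloisExtension_of_center [FiniteDimensional F A]
    (hdim : Module.finrank F A = Nat.card G)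
    (hL : IsGaloisExtension (QuotientGroup.kerLift (centerAction σ)))
    {ζ : F} (hζ : IsPrimitiveRoot ζ (Monoid.exponent (centerAction σ).ker))
    {u : ((centerAction σ).ker →* Fˣ) → Aˣ}
    (hu : ∀ χ, (u χ : A) ∈ characterEigenspace σ (centerAction σ).ker χ) :
    IsGaloisExtension σ := by
  cases nonempty_fintype G
  have hA : Nontrivial A := Module.nontrivial_of_finrank_pos (R := F) (hdim ▸ Nat.card_pos)
  obtain ⟨S, hS⟩ := exists_isDualSystem_of_center hL hζ hu
  have hsurj := hS.surjective_galoisMap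
  refine ⟨hA, inferInstance, ?_, fun c => ⟨fun hc => ?_, fun hc g => ?_⟩, ?_, hsurj⟩
  · rw [injective_iff_map_eq_one]
    intro g hg
    by_contra hne
    have h1 := hS.sum_ne_one g hne
    simp only [hg, AlgEquiv.one_apply, hS.sum_one] at h1
    exact one_ne_zero h1
  · have hcL := mem_center_of_forall_ker hdim hL hζ hu fun k _ => hc k
    have h1 : (⟨c, hcL⟩ : Subalgebra.center F A) ∈ (⊥ : Subalgebra F _) := by
      refine (hL.fixed _).1 fun q => ?_
      induction q using QuotientGroup.induction_on with
      | H g => exact Subtype.ext (hc g)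
    obtain ⟨r, hr⟩ := Algebra.mem_bot.1 h1
    exact Algebra.mem_bot.2 ⟨r, congrArg Subtype.val hr⟩
  · obtain ⟨r, rfl⟩ := Algebra.mem_bot.1 hc
    exact (σ g).commutes r
  · refine (LinearMap.injective_iff_surjective_of_finrank_eq_finrank ?_).2 hsurj
    rw [Module.finrank_tensorProduct, Module.finrank_pi_fintype, Finset.sum_const, smul_eq_mul,
      Finset.card_univ, hdim, Nat.card_eq_fintype_card]

end Backward

theorem corollary4p6 {F A G : Type*} [Field F] [Ring A] [Algebra F A] [FiniteDimensional F A]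
    [CommGroup G] [Finite G] (σ : G →* (A ≃ₐ[F] A)) :
    IsGaloisExtension σ ↔
      (Module.finrank F A = Nat.card G ∧
        IsGaloisExtension (QuotientGroup.kerLift (centerAction σ)) ∧
        (∃ ζ : F, IsPrimitiveRoot ζ (Monoid.exponent (centerAction σ).ker)) ∧
        ∀ χ : (centerAction σ).ker →* Fˣ,
          ∃ a ∈ characterEigenspace σ (centerAction σ).ker χ, IsUnit a) := by
  refine ⟨fun h => ⟨h.finrank_eq, h.center, h.conditions⟩, ?_⟩
  rintro ⟨hdim, hL, ⟨ζ, hζ⟩, hunit⟩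
  choose a ha hau using hunit
  exact isGaloisExtension_of_center hdim hL hζ (u := fun χ => (hau χ).unit) ha
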